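/- Theorem 2.1. Let $d\ge 1$ and $n\ge 1$ be integers, let $\alpha>0$, let $\Omega\subset\mathbb{R}^d$ be a nonempty bounded open set, and let $f\in L^2(\Omega)$ with $f\ge 0$ almost everywhere in $\Omega$. Put $r=\alpha n^{-1/d}$, let $\Omega_r=\{x\in\mathbb{R}^d : \operatorname{dist}(x,\Omega)<r\}$, and let $$\mathcal{A}(\alpha,n)(\Omega)=\Big\{\overline{\Omega}\cap\bigcup_{i=1}^n\overline{B(x_i,r)} \;:\; x_1,\dots,x_n\in\Omega_r\Big\}.$$ For every $\Sigma\in\mathcal{A}(\alpha,n)(\Omega)$ there is exactly one function $u=u_{f,\Sigma,\Omega}\in H^1_0(\Omega\setminus\Sigma)$, extended by zero outside $\Omega\setminus\Sigma$, such that $$\int_\Omega\nabla u\cdot\nabla\varphi\,dx=\int_\Omega f\varphi\,dx\qquad\text{for all }\varphi\in H^1_0(\Omega\setminus\Sigma),$$ and, with the compliance defined by $F(\Sigma,f,\Omega)=\int_\Omega f\,u_{f,\Sigma,\Omega}\,dx$, the problem $$\min\{F(\Sigma,f,\Omega) : \Sigma\in\mathcal{A}(\alpha,n)(\Omega)\}$$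 admits a solution, that is, there is $\Sigma^*\in\mathcal{A}(\alpha,n)(\Omega)$ with $F(\Sigma^*,f,\Omega)\le F(\Sigma,f,\Omega)$ for all $\Sigma\in\mathcal{A}(\alpha,n)(\Omega)$. -/

import Mathlib

open MeasureTheory Set
open scoped ContDiff RealInnerProductSpace

noncomputable section

/-- The Hilbert space `L²(ℝᵈ) × L²(ℝᵈ; ℝᵈ)`, with the norm `(‖u‖² + ‖g‖²)^(1/2)`. A Sobolev function
`u ∈ H¹(ℝᵈ)` is represented in it by the pair `(u, ∇u)`, whose norm is the `H¹` norm of `u`. -/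
abbrev L2Pair (d : ℕ) : Type :=
  WithLp 2 (Lp ℝ 2 (volume : Measure (EuclideanSpace ℝ (Fin d))) ×
    Lp (EuclideanSpace ℝ (Fin d)) 2 (volume : Measure (EuclideanSpace ℝ (Fin d))))

/-- `φ ∈ C_c^∞(U)`, extended by zero to the whole of `ℝᵈ`. -/
structure IsTestFunction {d : ℕ} (U : Set (EuclideanSpace ℝ (Fin d)))
    (φ : EuclideanSpace ℝ (Fin d) → ℝ) : Prop where
  contDiff : ContDiff ℝ ∞ φ
  hasCompactSupport : HasCompactSupport φ
  tsupport_subset : tsupport φ ⊆ U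

/-- The pairs `(φ, ∇φ)` with `φ ∈ C_c^∞(U)`. -/
def testPairs {d : ℕ} (U : Set (EuclideanSpace ℝ (Fin d))) : Submodule ℝ (L2Pair d) where
  carrier := {p | ∃ φ : EuclideanSpace ℝ (Fin d) → ℝ, IsTestFunction U φ ∧
    p.fst =ᵐ[volume] φ ∧ p.snd =ᵐ[volume] gradient φ}
  zero_mem' := by
    refine ⟨0, ⟨contDiff_const, HasCompactSupport.zero, by simp⟩, Lp.coeFn_zero _ _ _, ?_⟩
    have h : gradient (0 : EuclideanSpace ℝ (Fin d) → ℝ) = 0 := by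
      ext1 x; exact gradient_fun_const x 0
    rw [h]
    exact Lp.coeFn_zero _ _ _
  add_mem' := by
    rintro p q ⟨φ, hφ, hp1, hp2⟩ ⟨ψ, hψ, hq1, hq2⟩
    refine ⟨φ + ψ, ⟨hφ.1.add hψ.1, hφ.2.add hψ.2,
      (tsupport_add φ ψ).trans (union_subset hφ.3 hψ.3)⟩, ?_, ?_⟩
    · filter_upwards [Lp.coeFn_add p.fst q.fst, hp1, hq1] with x h h1 h2
      simp only [WithLp.add_fst, Pi.add_apply] at h ⊢
      rw [h, h1, h2]
    · filter_upwards [Lp.coeFn_add p.snd q.snd, hp2, hq2] with x h h1 h2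
      have d1 : DifferentiableAt ℝ φ x := hφ.1.differentiable (by simp) x
      have d2 : DifferentiableAt ℝ ψ x := hψ.1.differentiable (by simp) x
      simp only [WithLp.add_snd, Pi.add_apply] at h ⊢
      rw [h, h1, h2]
      simp only [gradient]
      rw [fderiv_add d1 d2, map_add]
  smul_mem' := by
    rintro c p ⟨φ, hφ, hp1, hp2⟩
    refine ⟨c • φ, ⟨hφ.1.const_smul c, hφ.2.smul_left (f := fun _ => c),
      (tsupport_smul_subset_right (fun _ => c) φ).trans hφ.3⟩, ?_, ?_⟩
    · filter_upwards [Lp.coeFn_smul c p.fst, hp1] with x h h1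
      simp only [WithLp.smul_fst, Pi.smul_apply] at h ⊢
      rw [h, h1]
    · filter_upwards [Lp.coeFn_smul c p.snd, hp2] with x h h1
      have d1 : DifferentiableAt ℝ φ x := hφ.1.differentiable (by simp) x
      simp only [WithLp.smul_snd, Pi.smul_apply] at h ⊢
      rw [h, h1]
      simp only [gradient]
      rw [fderiv_const_smul d1, map_smul]

/-- The Sobolev space `H¹₀(U)`, the closure of `C_c^∞(U)` in the `H¹` norm. Its elements `u` are
extended by zero outside `U` and stored together with their weak gradient as the pair `(u, ∇u)`. -/
def H10 {d : ℕ} (U : Set (EuclideanSpace ℝ (Fin d))) : Submodule ℝ (L2Pair d) :=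
  (testPairs U).topologicalClosure

/-- `u` is the weak solution of `-Δu = f` in `Ω \ S`, `u = 0` on `S ∪ ∂Ω`: it lies in
`H¹₀(Ω \ S)`, and `∫_Ω ∇u · ∇φ = ∫_Ω f φ` for every `φ ∈ H¹₀(Ω \ S)`.
(`u.fst` is the function and `u.snd` its gradient.) -/
def IsWeakSolution {d : ℕ} (S : Set (EuclideanSpace ℝ (Fin d)))
    (f : EuclideanSpace ℝ (Fin d) → ℝ) (Ω : Set (EuclideanSpace ℝ (Fin d)))
    (u : L2Pair d) : Prop :=
  u ∈ H10 (Ω \ S) ∧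
    ∀ φ ∈ H10 (Ω \ S), ∫ x in Ω, ⟪u.snd x, φ.snd x⟫ = ∫ x in Ω, f x * φ.fst x

/-- The solution `u_{f,S,Ω}`; it is meaningful when the weak solution exists and is unique. -/
def solution {d : ℕ} (S : Set (EuclideanSpace ℝ (Fin d)))
    (f : EuclideanSpace ℝ (Fin d) → ℝ) (Ω : Set (EuclideanSpace ℝ (Fin d))) : L2Pair d :=
  Classical.epsilon (IsWeakSolution S f Ω)

/-- The compliance `F(S, f, Ω) = ∫_Ω f u_{f,S,Ω}`. -/
def compliance {d : ℕ} (S : Set (EuclideanSpace ℝ (Fin d)))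
    (f : EuclideanSpace ℝ (Fin d) → ℝ) (Ω : Set (EuclideanSpace ℝ (Fin d))) : ℝ :=
  ∫ x in Ω, f x * (solution S f Ω).fst x

/-- The class of the sets `closure Ω ∩ ⋃ i, closedBall (x i) r` with `r = α n^(-1/d)` and
centres `x 1, …, x n` in the open `r`-neighbourhood of `Ω`. -/
def admissible {d : ℕ} (α : ℝ) (n : ℕ) (Ω : Set (EuclideanSpace ℝ (Fin d))) :
    Set (Set (EuclideanSpace ℝ (Fin d))) :=
  {S | ∃ x : Fin n → EuclideanSpace ℝ (Fin d),
    (∀ i, x i ∈ Metric.thickening (α * (n : ℝ) ^ (-(1 : ℝ) / (d : ℝ))) Ω) ∧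
    S = closure Ω ∩ ⋃ i, Metric.closedBall (x i) (α * (n : ℝ) ^ (-(1 : ℝ) / (d : ℝ)))}

end

open MeasureTheory Set Filter Topology
open scoped ContDiff RealInnerProductSpace

/-! By Poincaré, the gradient norm controls the full norm on `H10 (Ω \ S)`, so Lax–Milgram solves
each equation uniquely. Its solution maximizes `2 ∫ f v - ∫ |∇v|²` over `H10 (Ω \ S)`, with maximum
the compliance; hence removing more of `Ω` can only lower it (`compliance_le_of_diff_subset`).

The compliance is lower semicontinuous in the centres: a test function with nearly maximal energy
has compact support away from the balls, so it stays admissible when they move slightly. It thus has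
a minimum over centres in the compact closure of the open neighbourhood. A centre outside the open
neighbourhood has a ball missing `Ω`; moving it to a point of `Ω` does not raise the compliance. -/

section Hilbert

variable {V H : Type*} [NormedAddCommGroup V] [InnerProductSpace ℝ V] [CompleteSpace V]
  [NormedAddCommGroup H] [InnerProductSpace ℝ H]

/-- Unique solvability of `⟪T u, T v⟫ = ℓ v` when `T` is bounded below. -/
theorem existsUnique_inner_map_eq (T : V →L[ℝ] H) (ℓ : V →L[ℝ] ℝ) {C : ℝ}
    (hT : ∀ v, ‖v‖ ^ 2 ≤ C * ‖T v‖ ^ 2) : ∃! u, ∀ v, ⟪T u, T v⟫ = ℓ v := by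
  let B : V →L[ℝ] V →L[ℝ] ℝ :=
    (isBoundedBilinearMap_inner (𝕜 := ℝ) (E := H)).toContinuousLinearMap.bilinearComp T T
  have hB : ∀ u v, B u v = ⟪T u, T v⟫ := fun _ _ => rfl
  have hc : IsCoercive B := by
    refine ⟨(max C 1)⁻¹, by positivity, fun u => ?_⟩
    rw [hB, real_inner_self_eq_norm_sq, mul_assoc, ← sq, inv_mul_le_iff₀ (by positivity)]
    exact (hT u).trans (mul_le_mul_of_nonneg_right (le_max_left _ _) (sq_nonneg _))
  let e := hc.continuousLinearEquivOfBilin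
  let w := (InnerProductSpace.toDual ℝ V).symm ℓ
  have hw : ∀ v, ⟪w, v⟫ = ℓ v := fun v => InnerProductSpace.toDual_symm_apply
  refine ⟨e.symm w, fun v => ?_, fun u hu => ?_⟩
  · rw [← hB, ← hc.continuousLinearEquivOfBilin_apply, ← hw]
    exact congrArg (⟪·, v⟫) (e.apply_symm_apply w)
  · rw [e.eq_symm_apply]
    refine ext_inner_right ℝ fun v => ?_
    rw [hw, ← hu, ← hB]
    exact hc.continuousLinearEquivOfBilin_apply u v

end Hilbert

/-! ### Poincaré inequality on bounded sets. -/

section Poincare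

variable {d : ℕ}

theorem IsTestFunction.mono {U W : Set (EuclideanSpace ℝ (Fin d))} (h : U ⊆ W)
    {φ : EuclideanSpace ℝ (Fin d) → ℝ} (hφ : IsTestFunction U φ) : IsTestFunction W φ :=
  ⟨hφ.1, hφ.2, hφ.3.trans h⟩

theorem testPairs_mono {U W : Set (EuclideanSpace ℝ (Fin d))} (h : U ⊆ W) :
    testPairs U ≤ testPairs W := by
  rintro p ⟨φ, hφ, h1, h2⟩
  exact ⟨φ, hφ.mono h, h1, h2⟩

theorem H10_mono {U W : Set (EuclideanSpace ℝ (Fin d))} (h : U ⊆ W) : H10 U ≤ H10 W :=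
  Submodule.topologicalClosure_mono (testPairs_mono h)

theorem norm_gradient_eq (φ : EuclideanSpace ℝ (Fin d) → ℝ) (x : EuclideanSpace ℝ (Fin d)) :
    ‖gradient φ x‖ = ‖fderiv ℝ φ x‖ :=
  (InnerProductSpace.toDual ℝ _).symm.norm_map _

/-- Young's inequality, from `(b + 2ac)² ≥ 0`; the weight 1/2 lets the `b²` term be absorbed in the
Poincaré estimate. -/
theorem neg_mul_le_half_sq_add {a b c m R : ℝ} (ha : |a| ≤ R) (hc : |c| ≤ m) :
    -(a * (2 * b * c)) ≤ b ^ 2 / 2 + 2 * R ^ 2 * m ^ 2 := by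
  have h : (a * c) ^ 2 ≤ (R * m) ^ 2 := by
    rw [← sq_abs, abs_mul]
    gcongr
    exact (abs_nonneg a).trans ha
  nlinarith [sq_nonneg (b + 2 * (a * c))]

/-- The Poincaré inequality for smooth functions supported in a ball. -/
theorem integral_sq_le_integral_fderiv_sq (i : Fin d) {R : ℝ} {φ : EuclideanSpace ℝ (Fin d) → ℝ}
    (hφ : ContDiff ℝ ∞ φ) (hc : HasCompactSupport φ)
    (hR : tsupport φ ⊆ Metric.closedBall 0 R) :
    ∫ x, φ x ^ 2 ≤ 4 * R ^ 2 * ∫ x, ‖fderiv ℝ φ x‖ ^ 2 := by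
  set e : EuclideanSpace ℝ (Fin d) := EuclideanSpace.single i 1
  let L : EuclideanSpace ℝ (Fin d) →L[ℝ] ℝ := EuclideanSpace.proj i
  have hLe : L e = 1 := by simp [L, e]
  have hdiff : Differentiable ℝ φ := hφ.differentiable (by simp)
  have hcd : Continuous (fderiv ℝ φ) := hφ.continuous_fderiv (by simp)
  have hsd : HasCompactSupport (fderiv ℝ φ) := hc.fderiv ℝ
  have hdsq : ∀ x, fderiv ℝ (fun y => φ y ^ 2) x e = 2 * φ x * fderiv ℝ φ x e := fun x => by
    rw [((hdiff x).hasFDerivAt.pow 2).fderiv]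
    simp
  have hφc := hφ.continuous
  have hi1 : Integrable (fun x => φ x ^ 2) :=
    Continuous.integrable_of_hasCompactSupport (by fun_prop)
      (hc.mono fun x hx h => hx (by simp [h]))
  have hi2 : Integrable (fun x => ‖fderiv ℝ φ x‖ ^ 2) :=
    Continuous.integrable_of_hasCompactSupport (by fun_prop)
      (hsd.mono fun x hx h => hx (by simp [h]))
  have hi3 : Integrable (fun x => L x * (2 * φ x * fderiv ℝ φ x e)) :=
    Continuous.integrable_of_hasCompactSupport (by fun_prop)
      (hc.mono fun x hx h => hx (by simp [h]))
  have hi4 : Integrable (fun x => L x * φ x ^ 2) :=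
    Continuous.integrable_of_hasCompactSupport (by fun_prop)
      (hc.mono fun x hx h => hx (by simp [h]))
  -- Integrating `φ²` by parts against the coordinate `L`, whose derivative along `e` is 1.
  have key := integral_mul_fderiv_eq_neg_fderiv_mul_of_integrable (μ := volume) (f := L)
    (g := fun y => φ y ^ 2) (v := e) (by simpa [hLe] using hi1)
    (by simpa only [hdsq] using hi3) hi4 (fun x _ => L.differentiableAt)
    (fun x _ => (hdiff x).pow 2)
  simp only [hdsq, L.fderiv, hLe, one_mul] at key
  have hpt : ∀ x, -(L x * (2 * φ x * fderiv ℝ φ x e)) ≤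
      φ x ^ 2 / 2 + 2 * R ^ 2 * ‖fderiv ℝ φ x‖ ^ 2 := fun x => by
    -- The bound `|L x| ≤ R` is available only on the support; elsewhere the left side vanishes.
    by_cases hx : φ x = 0
    · rw [hx, mul_zero, zero_mul, mul_zero, neg_zero]
      positivity
    · have hxR : ‖x‖ ≤ R := by simpa using hR (subset_tsupport φ hx)
      refine neg_mul_le_half_sq_add ((PiLp.norm_apply_le x i).trans hxR) ?_
      simpa [e] using (fderiv ℝ φ x).le_opNorm e
  have hint : -∫ x, L x * (2 * φ x * fderiv ℝ φ x e) ≤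
      ∫ x, φ x ^ 2 / 2 + 2 * R ^ 2 * ‖fderiv ℝ φ x‖ ^ 2 := by
    rw [← integral_neg]
    exact integral_mono hi3.neg ((hi1.div_const 2).add (hi2.const_mul _)) hpt
  rw [key, neg_neg, integral_add (hi1.div_const 2) (hi2.const_mul _), integral_div,
    integral_const_mul] at hint
  linarith

theorem norm_sq_eq_integral {F : Type*} [NormedAddCommGroup F] [InnerProductSpace ℝ F]
    {X : Type*} [MeasurableSpace X] {μ : Measure X} (g : Lp F 2 μ) :
    ‖g‖ ^ 2 = ∫ x, ‖g x‖ ^ 2 ∂μ := by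
  rw [← real_inner_self_eq_norm_sq, L2.inner_def]
  simp only [real_inner_self_eq_norm_sq]

/-- The Poincaré inequality in `H¹₀` of a bounded set. -/
theorem norm_sq_le_of_mem_H10 (hd : 1 ≤ d) {U : Set (EuclideanSpace ℝ (Fin d))} {R : ℝ}
    (hU : U ⊆ Metric.closedBall 0 R) {p : L2Pair d} (hp : p ∈ H10 U) :
    ‖p‖ ^ 2 ≤ (4 * R ^ 2 + 1) * ‖p.snd‖ ^ 2 := by
  have hcl : IsClosed {p : L2Pair d | ‖p‖ ^ 2 ≤ (4 * R ^ 2 + 1) * ‖p.snd‖ ^ 2} :=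
    isClosed_le (by fun_prop) (by fun_prop)
  refine closure_minimal (s := (testPairs U : Set (L2Pair d))) ?_ hcl hp
  rintro q ⟨φ, hφ, h1, h2⟩
  have e1 : ‖q.fst‖ ^ 2 = ∫ x, φ x ^ 2 := by
    rw [norm_sq_eq_integral]
    refine integral_congr_ae ?_
    filter_upwards [h1] with x hx
    rw [hx, Real.norm_eq_abs, sq_abs]
  have e2 : ‖q.snd‖ ^ 2 = ∫ x, ‖fderiv ℝ φ x‖ ^ 2 := by
    rw [norm_sq_eq_integral]
    refine integral_congr_ae ?_
    filter_upwards [h2] with x hx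
    rw [hx, norm_gradient_eq]
  have := integral_sq_le_integral_fderiv_sq ⟨0, hd⟩ hφ.1 hφ.2 (hφ.3.trans hU)
  rw [mem_ofPred_eq, WithLp.prod_norm_sq_eq_of_L2, e1, e2]
  linarith

end Poincare

/-! ### Weak solutions and the variational form of the compliance. -/

section WeakForm

variable {d : ℕ} {Ω U : Set (EuclideanSpace ℝ (Fin d))}

/-- Gradients of functions in `H¹₀(U)` vanish outside `U`, so they may be integrated over any
measurable set containing `U`. -/
theorem setIntegral_inner_snd_eq (hΩ : MeasurableSet Ω) (hU : U ⊆ Ω) {p : L2Pair d}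
    (hp : p ∈ H10 U) (q : L2Pair d) : ∫ x in Ω, ⟪p.snd x, q.snd x⟫ = ⟪p.snd, q.snd⟫ := by
  -- Cutting off `q.snd` turns the integral over `Ω` into an inner product, hence continuous in `p`.
  have hm : MemLp (Ω.indicator q.snd) 2 volume := (Lp.memLp q.snd).indicator hΩ
  have hL : ∀ p : L2Pair d, ∫ x in Ω, ⟪p.snd x, q.snd x⟫ = ⟪p.snd, hm.toLp _⟫ := fun p => by
    rw [L2.inner_def, ← integral_indicator hΩ]
    refine integral_congr_ae ?_
    filter_upwards [hm.coeFn_toLp] with x hx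
    rw [hx]
    by_cases h : x ∈ Ω <;> simp [h]
  have hcl : IsClosed {p : L2Pair d | ∫ x in Ω, ⟪p.snd x, q.snd x⟫ = ⟪p.snd, q.snd⟫} := by
    simp only [hL]
    exact isClosed_eq (by fun_prop) (by fun_prop)
  refine closure_minimal (s := (testPairs U : Set (L2Pair d))) ?_ hcl hp
  rintro r ⟨φ, hφ, h1, h2⟩
  rw [mem_ofPred_eq, L2.inner_def, ← integral_indicator hΩ]
  refine integral_congr_ae ?_
  filter_upwards [h2] with x hx
  by_cases h : x ∈ Ω
  · simp [h]
  · have : fderiv ℝ φ x = 0 :=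
      image_eq_zero_of_notMem_tsupport fun h' => h (hU (hφ.3 (tsupport_fderiv_subset ℝ h')))
    simp [h, hx, gradient, this]

variable {f : EuclideanSpace ℝ (Fin d) → ℝ}

/-- The extension of `f ∈ L²(Ω)` by zero, as an element of `L²(ℝᵈ)`. -/
noncomputable def zeroExtension (hΩ : MeasurableSet Ω) (hf : MemLp f 2 (volume.restrict Ω)) :
    Lp ℝ 2 (volume : Measure (EuclideanSpace ℝ (Fin d))) :=
  ((memLp_indicator_iff_restrict hΩ).2 hf).toLp _

theorem setIntegral_mul_eq (hΩ : MeasurableSet Ω) (hf : MemLp f 2 (volume.restrict Ω))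
    (w : Lp ℝ 2 (volume : Measure (EuclideanSpace ℝ (Fin d)))) :
    ∫ x in Ω, f x * w x = ⟪zeroExtension hΩ hf, w⟫ := by
  rw [L2.inner_def, ← integral_indicator hΩ]
  refine integral_congr_ae ?_
  filter_upwards [((memLp_indicator_iff_restrict hΩ).2 hf).coeFn_toLp] with x hx
  rw [zeroExtension, hx]
  by_cases h : x ∈ Ω <;> simp [h, mul_comm]

variable {S S' : Set (EuclideanSpace ℝ (Fin d))}

theorem isWeakSolution_iff (hΩ : MeasurableSet Ω) (hf : MemLp f 2 (volume.restrict Ω))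
    {u : L2Pair d} :
    IsWeakSolution S f Ω u ↔ u ∈ H10 (Ω \ S) ∧
      ∀ φ ∈ H10 (Ω \ S), ⟪u.snd, φ.snd⟫ = ⟪zeroExtension hΩ hf, φ.fst⟫ := by
  refine and_congr_right fun hu => forall₂_congr fun φ _ => ?_
  rw [setIntegral_inner_snd_eq hΩ sdiff_subset hu, setIntegral_mul_eq]

theorem existsUnique_isWeakSolution (hd : 1 ≤ d) (hΩ : MeasurableSet Ω)
    (hΩb : Bornology.IsBounded Ω) (hf : MemLp f 2 (volume.restrict Ω)) :
    ∃! u : L2Pair d, IsWeakSolution S f Ω u := by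
  obtain ⟨R, hR⟩ := hΩb.subset_closedBall 0
  have : CompleteSpace (H10 (Ω \ S)) :=
    (Submodule.isClosed_topologicalClosure _).completeSpace_coe
  let T := (WithLp.sndL 2 ℝ (Lp ℝ 2 (volume : Measure (EuclideanSpace ℝ (Fin d))))
    (Lp (EuclideanSpace ℝ (Fin d)) 2 (volume : Measure (EuclideanSpace ℝ (Fin d))))).comp
    (H10 (Ω \ S)).subtypeL
  let ℓ := (innerSL ℝ (zeroExtension hΩ hf)).comp
    ((WithLp.fstL 2 ℝ (Lp ℝ 2 (volume : Measure (EuclideanSpace ℝ (Fin d))))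
    (Lp (EuclideanSpace ℝ (Fin d)) 2 (volume : Measure (EuclideanSpace ℝ (Fin d))))).comp
    (H10 (Ω \ S)).subtypeL)
  obtain ⟨u, hu, huniq⟩ := existsUnique_inner_map_eq T ℓ
    (fun v => norm_sq_le_of_mem_H10 hd (sdiff_subset.trans hR) v.2)
  refine ⟨u, (isWeakSolution_iff hΩ hf).2 ⟨u.2, fun φ hφ => hu ⟨φ, hφ⟩⟩, fun w hw => ?_⟩
  obtain ⟨hw1, hw2⟩ := (isWeakSolution_iff hΩ hf).1 hw
  exact congrArg Subtype.val (huniq ⟨w, hw1⟩ fun v => hw2 v v.2)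

/-- The functional whose maximum over `H¹₀(Ω \ S)` is the compliance of `S`. -/
noncomputable def energy (g : Lp ℝ 2 (volume : Measure (EuclideanSpace ℝ (Fin d))))
    (v : L2Pair d) : ℝ :=
  2 * ⟪g, v.fst⟫ - ‖v.snd‖ ^ 2

theorem continuous_energy (g : Lp ℝ 2 (volume : Measure (EuclideanSpace ℝ (Fin d)))) :
    Continuous (energy g) := by
  unfold energy
  fun_prop

theorem isWeakSolution_solution (hd : 1 ≤ d) (hΩ : MeasurableSet Ω)
    (hΩb : Bornology.IsBounded Ω) (hf : MemLp f 2 (volume.restrict Ω)) :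
    IsWeakSolution S f Ω (solution S f Ω) :=
  Classical.epsilon_spec (existsUnique_isWeakSolution hd hΩ hΩb hf).exists

theorem energy_solution (hd : 1 ≤ d) (hΩ : MeasurableSet Ω)
    (hΩb : Bornology.IsBounded Ω) (hf : MemLp f 2 (volume.restrict Ω)) :
    energy (zeroExtension hΩ hf) (solution S f Ω) = compliance S f Ω := by
  obtain ⟨h1, h2⟩ := (isWeakSolution_iff hΩ hf).1
    (isWeakSolution_solution (S := S) hd hΩ hΩb hf)
  rw [energy, compliance, setIntegral_mul_eq hΩ hf, ← real_inner_self_eq_norm_sq, h2 _ h1]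
  ring

/-- Completing the square: the gap is `‖∇u - ∇v‖²`, with `u` the solution. -/
theorem energy_le_compliance (hd : 1 ≤ d) (hΩ : MeasurableSet Ω)
    (hΩb : Bornology.IsBounded Ω) (hf : MemLp f 2 (volume.restrict Ω)) {v : L2Pair d}
    (hv : v ∈ H10 (Ω \ S)) : energy (zeroExtension hΩ hf) v ≤ compliance S f Ω := by
  obtain ⟨h1, h2⟩ := (isWeakSolution_iff hΩ hf).1
    (isWeakSolution_solution (S := S) hd hΩ hΩb hf)
  rw [energy, compliance, setIntegral_mul_eq hΩ hf, ← h2 v hv, ← h2 _ h1]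
  have := real_inner_self_nonneg (x := (solution S f Ω).snd - v.snd)
  rw [real_inner_sub_sub_self, real_inner_self_eq_norm_sq v.snd] at this
  linarith

theorem compliance_le_of_diff_subset (hd : 1 ≤ d) (hΩ : MeasurableSet Ω)
    (hΩb : Bornology.IsBounded Ω) (hf : MemLp f 2 (volume.restrict Ω)) (h : Ω \ S ⊆ Ω \ S') :
    compliance S f Ω ≤ compliance S' f Ω := by
  rw [← energy_solution hd hΩ hΩb hf]
  exact energy_le_compliance hd hΩ hΩb hf
    (H10_mono h (isWeakSolution_solution hd hΩ hΩb hf).1)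

end WeakForm

/-! ### Dependence on the centres. -/

section Balls

variable {d n : ℕ} {Ω : Set (EuclideanSpace ℝ (Fin d))}

theorem diff_closure_inter (A : Set (EuclideanSpace ℝ (Fin d))) :
    Ω \ (closure Ω ∩ A) = Ω \ A := by
  rw [sdiff_inter, sdiff_eq_empty.2 subset_closure, empty_union]

/-- A compact set avoiding finitely many closed balls avoids all nearby balls of the same radius. -/
theorem eventually_disjoint_iUnion_closedBall {K : Set (EuclideanSpace ℝ (Fin d))}
    (hK : IsCompact K) {r : ℝ} {x : Fin n → EuclideanSpace ℝ (Fin d)}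
    (h : Disjoint K (⋃ i, Metric.closedBall (x i) r)) :
    ∀ᶠ y in 𝓝 x, Disjoint K (⋃ i, Metric.closedBall (y i) r) := by
  simp only [disjoint_left, mem_iUnion, Metric.mem_closedBall, not_exists, not_le] at h ⊢
  refine hK.eventually_forall_of_forall_eventually fun z hz => eventually_all.2 fun i => ?_
  have hc : Continuous fun q : (Fin n → EuclideanSpace ℝ (Fin d)) × EuclideanSpace ℝ (Fin d) =>
      dist q.2 (q.1 i) := by fun_prop
  exact hc.continuousAt.eventually (lt_mem_nhds (h hz i))

/-- The compliance depends lower semicontinuously on the centres of the balls. -/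
theorem lowerSemicontinuous_compliance (hd : 1 ≤ d) (hΩ : MeasurableSet Ω)
    (hΩb : Bornology.IsBounded Ω) {f : EuclideanSpace ℝ (Fin d) → ℝ}
    (hf : MemLp f 2 (volume.restrict Ω)) (r : ℝ) :
    LowerSemicontinuous fun x : Fin n → EuclideanSpace ℝ (Fin d) =>
      compliance (closure Ω ∩ ⋃ i, Metric.closedBall (x i) r) f Ω := by
  intro x c hc
  change c < compliance (closure Ω ∩ ⋃ i, Metric.closedBall (x i) r) f Ω at hc
  have hsol := (isWeakSolution_solution (S := closure Ω ∩ ⋃ i, Metric.closedBall (x i) r)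
    hd hΩ hΩb hf).1
  rw [← energy_solution hd hΩ hΩb hf] at hc
  -- Density of test functions: one of them already has energy above `c`.
  obtain ⟨v, hv, φ, hφ, h1, h2⟩ := mem_closure_iff.1 hsol _
    (isOpen_lt continuous_const (continuous_energy _)) hc
  have hsub := hφ.3
  rw [diff_closure_inter, subset_sdiff] at hsub
  filter_upwards [eventually_disjoint_iUnion_closedBall hφ.2 hsub.2] with y hy
  refine lt_of_lt_of_le hv (energy_le_compliance hd hΩ hΩb hf
    (Submodule.le_topologicalClosure _ ⟨φ, ⟨hφ.1, hφ.2, ?_⟩, h1, h2⟩))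
  rw [diff_closure_inter]
  exact subset_sdiff.2 ⟨hsub.1, hy⟩

/-- A closed ball meeting an open set has its centre in the open neighbourhood of that set. -/
theorem mem_thickening_of_mem_closedBall (hΩ : IsOpen Ω) {r : ℝ} (hr : 0 < r)
    {x z : EuclideanSpace ℝ (Fin d)} (hz : z ∈ Ω) (hzx : z ∈ Metric.closedBall x r) :
    x ∈ Metric.thickening r Ω := by
  rw [← closure_ball x hr.ne'] at hzx
  obtain ⟨w, hw, hwx⟩ := mem_closure_iff.1 hzx Ω hΩ hz
  exact Metric.mem_thickening_iff.2 ⟨w, hw, by rwa [dist_comm]⟩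

end Balls

theorem theorem2p1 {d n : ℕ} (hd : 1 ≤ d) (hn : 1 ≤ n) {α : ℝ} (hα : 0 < α)
    {Ω : Set (EuclideanSpace ℝ (Fin d))} (hΩo : IsOpen Ω) (hΩb : Bornology.IsBounded Ω)
    (hΩn : Ω.Nonempty) {f : EuclideanSpace ℝ (Fin d) → ℝ}
    (hf : MemLp f 2 (volume.restrict Ω)) (hf0 : ∀ᵐ x ∂(volume.restrict Ω), 0 ≤ f x) :
    (∀ S ∈ admissible α n Ω, ∃! u : L2Pair d, IsWeakSolution S f Ω u) ∧
    ∃ S ∈ admissible α n Ω, ∀ S' ∈ admissible α n Ω,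
      compliance S f Ω ≤ compliance S' f Ω := by
  refine ⟨fun S _ => existsUnique_isWeakSolution hd hΩo.measurableSet hΩb hf, ?_⟩
  set r := α * (n : ℝ) ^ (-(1 : ℝ) / (d : ℝ)) with hrdef
  have hr : 0 < r := mul_pos hα (Real.rpow_pos_of_pos (by exact_mod_cast hn) _)
  obtain ⟨z, hz⟩ := hΩn
  let K : Set (Fin n → EuclideanSpace ℝ (Fin d)) :=
    Set.univ.pi fun _ => closure (Metric.thickening r Ω)
  have hK : IsCompact K := isCompact_univ_pi fun _ => hΩb.thickening.isCompact_closure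
  have hzr : z ∈ Metric.thickening r Ω := Metric.self_subset_thickening hr Ω hz
  have hKn : K.Nonempty := ⟨fun _ => z, fun _ _ => subset_closure hzr⟩
  obtain ⟨x, -, hx⟩ := ((lowerSemicontinuous_compliance (n := n) hd hΩo.measurableSet hΩb hf
    r).lowerSemicontinuousOn K).exists_isMinOn hKn hK
  classical
  -- Centres of the relaxed minimizer outside the open neighbourhood are replaced by `z`; their
  -- balls removed nothing from `Ω`.
  let y : Fin n → EuclideanSpace ℝ (Fin d) :=
    fun i => if x i ∈ Metric.thickening r Ω then x i else z
  refine ⟨_, ⟨y, fun i => ?_, rfl⟩, ?_⟩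
  · by_cases h : x i ∈ Metric.thickening r Ω <;> simp [y, h, ← hrdef, hzr]
  · rintro _ ⟨w, hw, rfl⟩
    refine le_trans (compliance_le_of_diff_subset hd hΩo.measurableSet hΩb hf ?_)
      (hx fun i _ => subset_closure (hw i))
    rw [diff_closure_inter, diff_closure_inter]
    rintro p ⟨hp, hpy⟩
    refine ⟨hp, fun hpx => hpy ?_⟩
    obtain ⟨i, hi⟩ := mem_iUnion.1 hpx
    refine mem_iUnion.2 ⟨i, ?_⟩
    simpa only [y, if_pos (mem_thickening_of_mem_closedBall hΩo hr hp hi)] using hi
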